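/- Model. Let $\Sigma$ be an alphabet with $2^\delta$ symbols and $F\in\Sigma^n$ a fixed string. In the online Hamming distance problem one maintains a string $S\in\Sigma^n$ (initially some $S_0\in\Sigma^n$) under the operation $\mathrm{arrive}(x)$, $x\in\Sigma$, which removes the leftmost symbol of $S$, appends $x$ on the right, and returns the Hamming distance between $F$ and the updated $S$. Algorithms are deterministic algorithms in the cell-probe model: the memory consists of $2^w$ cells of $w$ bits each, with $w$-bit addresses, where $w\ge\log_2 n$; an operation adaptively reads and writes cells, all other computation is free, and nothing but the memory is kept between operations. Symbols $U[0],\dots,U[n-1]$ arrive at times $0,\dots,n-1$. For $0\le t_0\le t_1<t_2<n$, the information transfer $IT(t_0,t_1,t_2)$ is the set of memory cells that are written during the time interval $[t_0,t_1]$ and are read during $[t_1+1,t_2]$ by some probe before which they have not been written during $[t_1+1,t_2]$. Statement. There are absolute constants $k>0$ and $C>0$ such that for all integers $\delta\ge 1$ and $n\ge(2^\delta-1)^2$ there exist a string $F\in\Sigma^n$ and a probability distribution of $U\in\Sigma^n$ with the following property. For every $w\ge\log_2 n$, every initial string $S_0\in\Sigma^n$, every algorithm with cells of $w$ bits that solves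 the online Hamming distance problem for $F$ starting from $S_0$, and any two adjacent intervals $[t_0,t_1]$ and $[t_1+1,t_2]$ in $\{0,\dots,n-1\}$ of the same length $2^\ell\ge k\sqrt n$ ($\ell\ge0$ an integer), $$\mathbb{E}\big[|IT(t_0,t_1,t_2)|\big]\;\ge\; C\cdot\frac{\delta}{w}\cdot 2^\ell .$$ -/

import Mathlib

namespace CellProbe

/-- A word of `w` bits: both the contents of a memory cell and the address of a memory cell. -/
abbrev Word (w : ℕ) : Type := Fin w → Bool

/-- The memory: one cell of `w` bits for every `w`-bit address. -/
abbrev Memory (w : ℕ) : Type := Word w → Word w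

/-- A single cell probe. -/
inductive Probe (w : ℕ) : Type
  | read (c : Word w) : Probe w
  | write (c : Word w) : Probe w

/-- The code of one operation in the cell-probe model. The next step (which cell is probed, what is
written, or what is returned) may depend in an arbitrary way on everything read so far during the
operation, since computation is free; nothing but the memory survives the operation. -/
inductive Code (w : ℕ) : Type
  | ret (out : ℕ) : Code w
  | read (c : Word w) (next : Word w → Code w) : Code w
  | write (c : Word w) (v : Word w) (next : Code w) : Code w

namespace Code

/-- The value returned by an operation started on memory `M`. -/
def output {w : ℕ} : Code w → Memory w → ℕ
  | ret out, _ => out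
  | read c next, M => (next (M c)).output M
  | write c v next, M => next.output (Function.update M c v)

/-- The memory left behind by an operation started on memory `M`. -/
def finalMemory {w : ℕ} : Code w → Memory w → Memory w
  | ret _, M => M
  | read c next, M => (next (M c)).finalMemory M
  | write c v next, M => next.finalMemory (Function.update M c v)

/-- The cell probes, in chronological order, of an operation started on memory `M`. -/
def probes {w : ℕ} : Code w → Memory w → List (Probe w)
  | ret _, _ => []
  | read c next, M => Probe.read c :: (next (M c)).probes M
  | write c v next, M => Probe.write c :: next.probes (Function.update M c v)

end Code

/-- A deterministic cell-probe algorithm, with cells of `w` bits, that supports the single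
operation `arrive x` for symbols `x` of the alphabet `α`. The initial memory is arbitrary. -/
structure Algorithm (w : ℕ) (α : Type) : Type where
  init : Memory w
  arrive : α → Code w

namespace Algorithm

variable {w : ℕ} {α : Type}

/-- The memory after the arrival of the symbols of `us`, started from memory `M`. -/
def memoryFrom (A : Algorithm w α) (M : Memory w) (us : List α) : Memory w :=
  us.foldl (fun M x => (A.arrive x).finalMemory M) M

/-- All cell probes, in chronological order, performed during the arrivals of the symbols
of `us`, started from memory `M`. -/
def probesFrom (A : Algorithm w α) : Memory w → List α → List (Probe w)
  | _, [] => []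
  | M, x :: us =>
      (A.arrive x).probes M ++ A.probesFrom ((A.arrive x).finalMemory M) us

/-- The answer to `arrive x` when it comes after the arrivals `us`. -/
def answer (A : Algorithm w α) (us : List α) (x : α) : ℕ :=
  (A.arrive x).output (A.memoryFrom A.init us)

/-- The cell probes, in chronological order, performed during the time interval `[a, b]` on the
update sequence `U`, where `U[t]` arrives at time `t = 0, 1, …`. -/
def probesDuring (A : Algorithm w α) (U : List α) (a b : ℕ) : List (Probe w) :=
  A.probesFrom (A.memoryFrom A.init (U.take a)) ((U.take (b + 1)).drop a)

open Classical in
/-- The information transfer `IT(t₀, t₁, t₂)`: the cells that are written during `[t₀, t₁]` and are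
read during `[t₁ + 1, t₂]` by some probe before which they have not been written
during `[t₁ + 1, t₂]`. -/
noncomputable def infoTransfer (A : Algorithm w α) (U : List α) (t₀ t₁ t₂ : ℕ) :
    Finset (Word w) :=
  Finset.univ.filter fun c =>
    Probe.write c ∈ A.probesDuring U t₀ t₁ ∧
      ∃ before after : List (Probe w),
        A.probesDuring U (t₁ + 1) t₂ = before ++ Probe.read c :: after ∧
          Probe.write c ∉ before

end Algorithm

/-- The string obtained from `S` by removing its leftmost symbol and appending `x` on the right. -/
def shiftIn {n : ℕ} {α : Type} (S : Fin n → α) (x : α) : Fin n → α :=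
  fun i => if h : i.val + 1 < n then S ⟨i.val + 1, h⟩ else x

/-- The algorithm `A` solves the online Hamming distance problem for the fixed string `F`, where
the maintained string is initially `S₀`: after every finite sequence `us` of arrivals, `arrive x`
returns the Hamming distance between `F` and the updated string. -/
def SolvesOnlineHamming {w n : ℕ} {α : Type} [DecidableEq α] (A : Algorithm w α)
    (F S₀ : Fin n → α) : Prop :=
  ∀ (us : List α) (x : α), A.answer us x = hammingDist F (shiftIn (us.foldl shiftIn S₀) x)

/-- The expectation of `|IT(t₀, t₁, t₂)|` when the `n` arriving symbols have distribution `P`. -/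
noncomputable def expectedInfoTransfer {w n : ℕ} {α : Type} [Fintype α] (A : Algorithm w α)
    (P : PMF (Fin n → α)) (t₀ t₁ t₂ : ℕ) : ℝ :=
  ∑ U : Fin n → α, (P U).toReal * ((A.infoTransfer (List.ofFn U) t₀ t₁ t₂).card : ℝ)

end CellProbe

/-! During the second interval both runs see the same arrivals, so the answers there depend only on
the symbols outside the first interval and on the cells of the information transfer with their
contents. If those answers determine about `2 ^ ℓ / 12` symbols of the first interval, each carrying
a constant fraction of `δ` bits, then the transfer encodes that much entropy at a cost of `O(w)`
bits per cell.

The work lies in building `F` so that answers determine symbols. The answer at time `t` compares `U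
s` with the symbol of `F` at distance `t - s` from its right end. Take times `t = z + j₀ + e ε`,
with `ε` a vertex of a cube and `e ε` a subset sum of integers `a i`, and form the alternating sum
over `ε`. Any symbol whose comparisons ignore one cube coordinate cancels. `Detects` asks that every
symbol except the last unknown one cancels, and that the survivor can be read off.

A detecting string labels each integer by the sign pattern of its short representation by the `a i`,
which is unique because the `a i` have no short linear relation (`exists_dissociated`). A
representation of a positive shift has a positive coordinate, and adding 0 or 1 there leaves the
pattern unchanged: this is the cancellation (`representationLabel_insert`). At shift zero the labels
form a cube labelling whose alternating counts identify the symbol (`exists_cube_labelling`). One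
string holds detectors at all large dyadic scales (`exists_multiscale_string`);
`eq_of_hammingDist_window_eq` decodes and `le_sum_card_of_encoding` counts. -/

namespace CellProbe

/-! ### Fresh reads and comparison of runs of one operation -/

/-- The cells read in a list of probes before being written in it. -/
def freshReads {w : ℕ} : List (Probe w) → Set (Word w)
  | [] => ∅
  | Probe.read c :: l => insert c (freshReads l)
  | Probe.write c :: l => freshReads l \ {c}

theorem mem_freshReads_iff {w : ℕ} (l : List (Probe w)) (c : Word w) :
    c ∈ freshReads l ↔ ∃ before after : List (Probe w),
      l = before ++ Probe.read c :: after ∧ Probe.write c ∉ before := by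
  induction l with
  | nil => simp [freshReads]
  | cons a l ih =>
    constructor
    · intro h
      cases a with
      | read d =>
        rcases h with rfl | h
        · exact ⟨[], l, rfl, by simp⟩
        · obtain ⟨b, a, rfl, hb⟩ := ih.1 h
          exact ⟨Probe.read d :: b, a, rfl, by simpa using hb⟩
      | write d =>
        obtain ⟨h, hd⟩ := h
        obtain ⟨b, a, rfl, hb⟩ := ih.1 h
        exact ⟨Probe.write d :: b, a, rfl, by simpa [hb] using hd⟩
    · rintro ⟨b, t, h, hb⟩
      cases b with
      | nil =>
        simp only [List.nil_append, List.cons.injEq] at h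
        rw [h.1]
        exact Or.inl rfl
      | cons b₀ b =>
        simp only [List.cons_append, List.cons.injEq] at h
        simp only [List.mem_cons, not_or] at hb
        have hl := ih.2 ⟨b, t, h.2, hb.2⟩
        rw [h.1]
        cases b₀ with
        | read d => exact Or.inr hl
        | write d => exact ⟨hl, fun hc => hb.1 (by rw [show c = d from hc])⟩

theorem mem_freshReads_append {w : ℕ} (l₁ l₂ : List (Probe w)) (c : Word w) :
    c ∈ freshReads (l₁ ++ l₂) ↔
      c ∈ freshReads l₁ ∨ (c ∈ freshReads l₂ ∧ Probe.write c ∉ l₁) := by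
  induction l₁ with
  | nil => simp [freshReads]
  | cons a l ih =>
    cases a with
    | read d => simp [freshReads, ih, or_assoc]
    | write d =>
      simp only [freshReads, List.cons_append, Set.mem_sdiff, ih, Set.mem_singleton_iff,
        List.mem_cons, not_or, Probe.write.injEq]
      tauto

namespace Code

theorem finalMemory_eq_of_not_written {w : ℕ} (p : Code w) (M : Memory w) (c : Word w)
    (h : Probe.write c ∉ p.probes M) : p.finalMemory M c = M c := by
  induction p generalizing M with
  | ret => rfl
  | read d next ih => exact ih _ _ (by simpa [probes] using h)
  | write d v next ih =>
    simp only [probes, List.mem_cons, not_or, Probe.write.injEq] at h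
    rw [finalMemory, ih _ h.2, Function.update_of_ne h.1]

/-- Two runs of an operation coincide if the memories agree on the cells that both runs read
before writing them. -/
theorem run_congr {w : ℕ} (p : Code w) (M₁ M₂ : Memory w)
    (h : ∀ c, c ∈ freshReads (p.probes M₁) → c ∈ freshReads (p.probes M₂) → M₁ c = M₂ c) :
    p.output M₁ = p.output M₂ ∧ p.probes M₁ = p.probes M₂ ∧
      ∀ c, Probe.write c ∈ p.probes M₁ → p.finalMemory M₁ c = p.finalMemory M₂ c := by
  induction p generalizing M₁ M₂ with
  | ret => simp [output, probes]
  | read d next ih =>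
    -- Up to their first discrepancy the two runs coincide, so the next read is fresh in both or in
    -- neither; agreement on the common fresh reads therefore suffices.
    have hd : M₁ d = M₂ d := h d (Or.inl rfl) (Or.inl rfl)
    have := ih (M₁ d) M₁ M₂ (fun c h₁ h₂ => h c (Or.inr h₁) (Or.inr (by rw [← hd]; exact h₂)))
    simp only [output, probes, finalMemory, ← hd]
    refine ⟨this.1, by rw [this.2.1], fun c hc => this.2.2 c (by simpa using hc)⟩
  | write d v next ih =>
    have key := ih (Function.update M₁ d v) (Function.update M₂ d v) (fun c h₁ h₂ => by
      by_cases hc : c = d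
      · subst hc; simp
      · rw [Function.update_of_ne hc, Function.update_of_ne hc]
        exact h c ⟨h₁, hc⟩ ⟨h₂, hc⟩)
    simp only [output, probes, finalMemory]
    refine ⟨key.1, by rw [key.2.1], fun c hc => ?_⟩
    by_cases hw : Probe.write c ∈ next.probes (Function.update M₁ d v)
    · exact key.2.2 c hw
    · have hcd : c = d := by simpa [hw] using hc
      rw [finalMemory_eq_of_not_written _ _ _ hw,
        finalMemory_eq_of_not_written _ _ _ (key.2.1 ▸ hw), hcd]
      simp

end Code

/-! ### The information transfer determines the answers -/

namespace Algorithm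

variable {w : ℕ} {α : Type}

theorem memoryFrom_append (A : Algorithm w α) (M : Memory w) (l₁ l₂ : List α) :
    A.memoryFrom M (l₁ ++ l₂) = A.memoryFrom (A.memoryFrom M l₁) l₂ := by
  simp [memoryFrom]

theorem memoryFrom_eq_of_not_written (A : Algorithm w α) (M : Memory w) (l : List α) (c : Word w)
    (h : Probe.write c ∉ A.probesFrom M l) : A.memoryFrom M l c = M c := by
  induction l generalizing M with
  | nil => rfl
  | cons x l ih =>
    simp only [probesFrom, List.mem_append, not_or] at h
    exact (ih _ h.2).trans (Code.finalMemory_eq_of_not_written _ _ _ h.1)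

/-- Two runs on the same arrivals return the same answers if the initial memories agree on the
cells that both runs read before writing them. -/
theorem output_congr (A : Algorithm w α) (M₁ M₂ : Memory w) (l₁ : List α) (x : α) (l₂ : List α)
    (h : ∀ c, c ∈ freshReads (A.probesFrom M₁ (l₁ ++ x :: l₂)) →
      c ∈ freshReads (A.probesFrom M₂ (l₁ ++ x :: l₂)) → M₁ c = M₂ c) :
    (A.arrive x).output (A.memoryFrom M₁ l₁) = (A.arrive x).output (A.memoryFrom M₂ l₁) := by
  induction l₁ generalizing M₁ M₂ with
  | nil =>
    refine (Code.run_congr _ M₁ M₂ fun c h₁ h₂ => h c ?_ ?_).1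
    · exact (mem_freshReads_append _ _ _).2 (Or.inl h₁)
    · exact (mem_freshReads_append _ _ _).2 (Or.inl h₂)
  | cons y l ih =>
    have key := Code.run_congr (A.arrive y) M₁ M₂ fun c h₁ h₂ =>
      h c ((mem_freshReads_append _ _ _).2 (Or.inl h₁))
        ((mem_freshReads_append _ _ _).2 (Or.inl h₂))
    refine ih _ _ fun c h₁ h₂ => ?_
    by_cases hc : Probe.write c ∈ (A.arrive y).probes M₁
    · exact key.2.2 c hc
    · have hc₂ : Probe.write c ∉ (A.arrive y).probes M₂ := key.2.1 ▸ hc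
      beta_reduce
      rw [Code.finalMemory_eq_of_not_written _ _ _ hc,
        Code.finalMemory_eq_of_not_written _ _ _ hc₂]
      exact h c ((mem_freshReads_append _ _ _).2 (Or.inr ⟨h₁, hc⟩))
        ((mem_freshReads_append _ _ _).2 (Or.inr ⟨h₂, hc₂⟩))

open Classical in
/-- The information transfer together with the contents, after time `t₁`, of its cells. -/
noncomputable def transferContents (A : Algorithm w α) (U : List α) (t₀ t₁ t₂ : ℕ) :
    Word w → Option (Word w) := fun c =>
  if c ∈ A.infoTransfer U t₀ t₁ t₂ then some (A.memoryFrom A.init (U.take (t₁ + 1)) c) else none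

theorem mem_infoTransfer (A : Algorithm w α) (U : List α) (t₀ t₁ t₂ : ℕ) (c : Word w) :
    c ∈ A.infoTransfer U t₀ t₁ t₂ ↔
      Probe.write c ∈ A.probesDuring U t₀ t₁ ∧ c ∈ freshReads (A.probesDuring U (t₁ + 1) t₂) := by
  simp [infoTransfer, mem_freshReads_iff]

theorem memory_eq_of_not_written (A : Algorithm w α) (U : List α) {t₀ t₁ : ℕ} (h : t₀ ≤ t₁ + 1)
    (c : Word w) (hc : Probe.write c ∉ A.probesDuring U t₀ t₁) :
    A.memoryFrom A.init (U.take (t₁ + 1)) c = A.memoryFrom A.init (U.take t₀) c := by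
  have hU : U.take (t₁ + 1) = U.take t₀ ++ (U.take (t₁ + 1)).drop t₀ := by
    conv_lhs => rw [← List.take_append_drop t₀ (U.take (t₁ + 1))]
    rw [List.take_take, min_eq_left h]
  rw [hU, memoryFrom_append]
  exact memoryFrom_eq_of_not_written _ _ _ _ hc

/-- The information transfer and the contents of its cells determine the answers during the
second interval. -/
theorem answer_eq_of_transferContents_eq (A : Algorithm w α) (U V : List α) {t₀ t₁ t₂ : ℕ}
    (h01 : t₀ ≤ t₁ + 1) (hpre : U.take t₀ = V.take t₀)
    (hpost : (U.take (t₂ + 1)).drop (t₁ + 1) = (V.take (t₂ + 1)).drop (t₁ + 1))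
    (hcode : A.transferContents U t₀ t₁ t₂ = A.transferContents V t₀ t₁ t₂)
    (l₁ : List α) (x : α) (l₂ : List α)
    (hl : (U.take (t₂ + 1)).drop (t₁ + 1) = l₁ ++ x :: l₂) :
    A.answer (U.take (t₁ + 1) ++ l₁) x = A.answer (V.take (t₁ + 1) ++ l₁) x := by
  rw [answer, answer, memoryFrom_append, memoryFrom_append]
  refine A.output_congr _ _ l₁ x l₂ fun c h₁ h₂ => ?_
  have hc := congrFun hcode c
  rw [← hl] at h₁
  rw [← hl, hpost] at h₂
  simp only [transferContents] at hc
  -- The cell `c` is fresh in both runs. In the transfer, its content is recorded; outside it, `c`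
  -- was not written during the first interval and still holds its value from time `t₀`, which the
  -- common prefix fixes.
  by_cases hU : c ∈ A.infoTransfer U t₀ t₁ t₂
  · by_cases hV : c ∈ A.infoTransfer V t₀ t₁ t₂
    · simpa [hU, hV] using hc
    · simp [hU, hV] at hc
  · by_cases hV : c ∈ A.infoTransfer V t₀ t₁ t₂
    · simp [hU, hV] at hc
    · rw [mem_infoTransfer] at hU hV
      rw [A.memory_eq_of_not_written U h01 c fun hw => hU ⟨hw, h₁⟩,
        A.memory_eq_of_not_written V h01 c fun hw => hV ⟨hw, h₂⟩, hpre]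

end Algorithm

/-! ### Labelling a cube with distinct alternating counts -/

section Cube

open Finset

variable {ι : Type*} [Fintype ι] [DecidableEq ι]

/-- The alternating sum over the cube `Finset ι` of the indicator function of `f = s`. -/
def alternatingCount (f : Finset ι → ℕ) (s : ℕ) : ℤ :=
  ∑ ε : Finset ι, (-1) ^ ε.card * if f ε = s then 1 else 0

/-- The vertices `ε` and `insert i ε` carry opposite signs and cancel in pairs. -/
theorem sum_neg_one_pow_mul_eq_zero (φ : Finset ι → ℤ) (i : ι)
    (h : ∀ ε, i ∉ ε → φ (insert i ε) = φ ε) : ∑ ε : Finset ι, (-1) ^ ε.card * φ ε = 0 := by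
  rw [← Finset.powerset_univ, ← Finset.insert_erase (Finset.mem_univ i),
    Finset.sum_powerset_insert (Finset.notMem_erase i _), ← Finset.sum_add_distrib]
  refine Finset.sum_eq_zero fun ε hε => ?_
  have hi : i ∉ ε := fun hi => Finset.notMem_erase i _ (Finset.mem_powerset.1 hε hi)
  rw [h ε hi, Finset.card_insert_of_notMem hi, pow_succ]
  ring

theorem alternatingCount_eq_zero (f : Finset ι → ℕ) (i : ι)
    (h : ∀ ε, i ∉ ε → f (insert i ε) = f ε) (s : ℕ) : alternatingCount f s = 0 :=
  sum_neg_one_pow_mul_eq_zero _ i fun ε hε => by rw [h ε hε]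

theorem two_mul_card_even [Nonempty ι] :
    2 * Fintype.card {ε : Finset ι // Even ε.card} = 2 ^ Fintype.card ι := by
  have h1 : ∑ ε : Finset ι, (1 + (-1 : ℤ) ^ ε.card) = 2 ^ Fintype.card ι := by
    have := sum_neg_one_pow_mul_eq_zero (fun _ : Finset ι => 1) (Classical.arbitrary ι)
      (fun _ _ => rfl)
    simp only [mul_one] at this
    rw [Finset.sum_add_distrib, this]
    simp
  have h2 : ∑ ε : Finset ι, (1 + (-1 : ℤ) ^ ε.card) =
      ∑ ε : Finset ι, if Even ε.card then 2 else 0 := by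
    refine Finset.sum_congr rfl fun ε _ => ?_
    split_ifs with h
    · rw [h.neg_one_pow]; norm_num
    · rw [(Nat.not_even_iff_odd.1 h).neg_one_pow]; norm_num
  rw [h2, ← Finset.sum_filter, Finset.sum_const, nsmul_eq_mul] at h1
  rw [Fintype.card_subtype]
  zify
  linarith

/-- The vertices of the cube of dimension `2 κ` can be labelled with `2 ^ κ` labels which are
distinguished by their alternating counts. -/
theorem exists_cube_labelling {κ : ℕ} (hκ : 1 ≤ κ) :
    ∃ f : Finset (Fin (2 * κ)) → ℕ, (∀ ε, f ε < 2 ^ κ) ∧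
      Set.InjOn (alternatingCount f) (Set.Iio (2 ^ κ)) := by
  classical
  have : Nonempty (Fin (2 * κ)) := ⟨⟨0, by omega⟩⟩
  -- Each label `s ≥ 1` is to be placed on exactly `s` even vertices. This needs `2 ^ κ * (2 ^ κ -
  -- 1) / 2` of them, and there are `2 ^ (2 * κ - 1)`. All other vertices get the label 0.
  have hcard : Fintype.card (Σ s : Fin (2 ^ κ), Fin s) ≤
      Fintype.card {ε : Finset (Fin (2 * κ)) // Even ε.card} := by
    have h1 := two_mul_card_even (ι := Fin (2 * κ))
    have h2 := Finset.sum_range_id_mul_two (2 ^ κ)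
    rw [Fintype.card_fin] at h1
    rw [Fintype.card_sigma]
    simp only [Fintype.card_fin]
    rw [Fin.sum_univ_eq_sum_range (fun i => i) (2 ^ κ)]
    have h3 : 2 ^ κ * (2 ^ κ - 1) ≤ 2 ^ (2 * κ) := by
      rw [two_mul, pow_add]
      exact Nat.mul_le_mul_left _ (Nat.sub_le _ _)
    omega
  obtain ⟨e⟩ := Function.Embedding.nonempty_of_card_le hcard
  let f : Finset (Fin (2 * κ)) → ℕ := fun ε =>
    if h : ∃ x, (e x : Finset (Fin (2 * κ))) = ε then h.choose.1 else 0
  have hfe : ∀ x, f (e x) = x.1 := by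
    intro x
    have h : ∃ y, (e y : Finset (Fin (2 * κ))) = e x := ⟨x, rfl⟩
    have : h.choose = x := e.injective (Subtype.ext h.choose_spec)
    simp only [f, dif_pos h, this]
  have hlt : ∀ ε, f ε < 2 ^ κ := by
    intro ε
    simp only [f]
    split_ifs with h
    · exact h.choose.1.2
    · positivity
  have hpos : ∀ s < 2 ^ κ, 1 ≤ s → alternatingCount f s = s := by
    intro s hs hs1
    have himg : (Finset.univ.filter fun ε => f ε = s) =
        Finset.univ.map ⟨fun i : Fin s => ((e ⟨⟨s, hs⟩, i⟩ : {ε // _}) : Finset (Fin (2 * κ))),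
          fun i j hij => by simpa using e.injective (Subtype.ext hij)⟩ := by
      ext ε
      simp only [mem_filter, mem_univ, true_and, mem_map]
      constructor
      · intro h
        by_cases hx : ∃ x, (e x : Finset (Fin (2 * κ))) = ε
        · obtain ⟨⟨⟨t, ht⟩, i⟩, rfl⟩ := hx
          rw [hfe] at h
          simp only at h
          subst h
          exact ⟨i, rfl⟩
        · simp only [f, dif_neg hx] at h
          omega
      · rintro ⟨i, rfl⟩
        exact hfe _
    rw [alternatingCount]
    simp only [mul_ite, mul_one, mul_zero]
    rw [← Finset.sum_filter, himg, Finset.sum_map]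
    exact (Finset.sum_congr rfl fun i _ => (e ⟨⟨s, hs⟩, i⟩).2.neg_one_pow).trans (by simp)
  -- The counts add up to the alternating sum of the constant 1, so the count of label 0 is at most
  -- 0 and differs from the positive ones.
  have hsum : ∑ s ∈ Finset.range (2 ^ κ), alternatingCount f s = 0 := by
    simp only [alternatingCount]
    rw [Finset.sum_comm]
    refine Eq.trans ?_ (sum_neg_one_pow_mul_eq_zero (fun _ => 1)
      (Classical.arbitrary (Fin (2 * κ))) (fun _ _ => rfl))
    refine Finset.sum_congr rfl fun ε _ => ?_
    rw [← Finset.mul_sum, Finset.sum_ite_eq, if_pos (Finset.mem_range.2 (hlt ε))]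
  have hzero : alternatingCount f 0 ≤ 0 := by
    have h2 : Finset.range (2 ^ κ) = insert 0 ((Finset.range (2 ^ κ)).erase 0) :=
      (Finset.insert_erase (Finset.mem_range.2 (by positivity))).symm
    rw [h2, Finset.sum_insert (Finset.notMem_erase _ _)] at hsum
    have : 0 ≤ ∑ s ∈ (Finset.range (2 ^ κ)).erase 0, alternatingCount f s := by
      refine Finset.sum_nonneg fun s hs => ?_
      rw [Finset.mem_erase, Finset.mem_range] at hs
      rw [hpos s hs.2 (by omega)]
      positivity
    linarith
  refine ⟨f, hlt, fun s hs t ht hst => ?_⟩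
  rw [Set.mem_Iio] at hs ht
  rcases Nat.eq_zero_or_pos s with rfl | hs0 <;> rcases Nat.eq_zero_or_pos t with rfl | ht0
  · rfl
  · rw [hpos t ht ht0] at hst; omega
  · rw [hpos s hs hs0] at hst; omega
  · rw [hpos s hs hs0, hpos t ht ht0] at hst; omega

end Cube

/-! ### Integers without short linear relations -/

section Dissociated

open Finset

theorem sum_Icc_half_pow_natAbs (N : ℕ) :
    ∑ m ∈ Finset.Icc (-(N : ℤ)) N, (1 / 2 : ℚ) ^ m.natAbs = 3 - 2 * (1 / 2) ^ N := by
  induction N with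
  | zero => norm_num
  | succ N ih =>
    have h : Finset.Icc (-((N + 1 : ℕ) : ℤ)) ((N + 1 : ℕ) : ℤ) =
        insert (-((N + 1 : ℕ) : ℤ)) (insert ((N + 1 : ℕ) : ℤ) (Finset.Icc (-(N : ℤ)) N)) := by
      ext m
      simp only [mem_Icc, mem_insert]
      push_cast
      omega
    rw [h, Finset.sum_insert, Finset.sum_insert, ih, Int.natAbs_neg, Int.natAbs_natCast, pow_succ]
    · ring
    · simp
    · simp only [mem_insert, mem_Icc]
      push_cast
      omega

/-- The integer vectors of `ℓ¹` norm at most `N`. -/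
noncomputable def integerBall (K N : ℕ) : Finset (Fin K → ℤ) :=
  (Fintype.piFinset fun _ => Finset.Icc (-(N : ℤ)) N).filter fun u => ∑ i, (u i).natAbs ≤ N

theorem mem_integerBall {K N : ℕ} (u : Fin K → ℤ) :
    u ∈ integerBall K N ↔ ∑ i, (u i).natAbs ≤ N := by
  simp only [integerBall, mem_filter, Fintype.mem_piFinset, mem_Icc, and_iff_right_iff_imp]
  intro h i
  have := Finset.single_le_sum (f := fun i => (u i).natAbs) (fun _ _ => Nat.zero_le _)
    (Finset.mem_univ i)
  omega

/-- Weight `u` by `2 ^ (N - ‖u‖₁)`, which is at least 1 on the ball; the sum factors over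
coordinates, each contributing less than 3. -/
theorem card_integerBall_le (K N : ℕ) : (integerBall K N).card ≤ 2 ^ N * 3 ^ K := by
  have h : ((integerBall K N).card : ℚ) ≤ 2 ^ N * 3 ^ K := by
    calc ((integerBall K N).card : ℚ) = ∑ u ∈ integerBall K N, 1 := by simp
      _ ≤ ∑ u ∈ integerBall K N, 2 ^ N * ∏ i, (1 / 2 : ℚ) ^ (u i).natAbs := by
          refine Finset.sum_le_sum fun u hu => ?_
          rw [Finset.prod_pow_eq_pow_sum]
          have h1 : (1 / 2 : ℚ) ^ N ≤ (1 / 2) ^ ∑ i, (u i).natAbs :=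
            pow_le_pow_of_le_one (by norm_num) (by norm_num) ((mem_integerBall u).1 hu)
          calc (1 : ℚ) = 2 ^ N * (1 / 2) ^ N := by rw [← mul_pow]; norm_num
            _ ≤ _ := by gcongr
      _ ≤ ∑ u ∈ Fintype.piFinset fun _ : Fin K => Finset.Icc (-(N : ℤ)) N,
            2 ^ N * ∏ i, (1 / 2 : ℚ) ^ (u i).natAbs :=
          Finset.sum_le_sum_of_subset_of_nonneg (Finset.filter_subset _ _)
            fun _ _ _ => by positivity
      _ = 2 ^ N * ∏ _i : Fin K, ∑ m ∈ Finset.Icc (-(N : ℤ)) N, (1 / 2 : ℚ) ^ m.natAbs := by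
          rw [← Finset.mul_sum, Finset.prod_univ_sum]
      _ ≤ 2 ^ N * 3 ^ K := by
          rw [sum_Icc_half_pow_natAbs, Finset.prod_const, Finset.card_univ, Fintype.card_fin]
          have h1 : (1 / 2 : ℚ) ^ N ≤ 1 := pow_le_one₀ (by norm_num) (by norm_num)
          gcongr
          · linarith
          · have : (0 : ℚ) ≤ (1 / 2) ^ N := by positivity
            linarith
  exact_mod_cast h

/-- A coordinate `i₀` with `u i₀ ≠ 0` is determined by the others. -/
theorem card_filter_sum_eq_zero_le {K : ℕ} (A : ℕ) (u : Fin K → ℤ) (hu : u ≠ 0) :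
    ((Fintype.piFinset fun _ : Fin K => Finset.Ico A (2 * A)).filter
      fun a => ∑ i, u i * (a i : ℤ) = 0).card ≤ A ^ (K - 1) := by
  obtain ⟨i₀, hi₀⟩ := Function.ne_iff.1 hu
  rw [Pi.zero_apply] at hi₀
  have hc : (Fintype.piFinset fun _ : {i : Fin K // i ≠ i₀} => Finset.Ico A (2 * A)).card =
      A ^ (K - 1) := by
    rw [Fintype.card_piFinset, Finset.prod_const, Nat.card_Ico, Finset.card_univ,
      Fintype.card_subtype_compl]
    simp [two_mul]
  rw [← hc]
  refine Finset.card_le_card_of_injOn (fun a i => a i) ?_ ?_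
  · intro a ha
    rw [mem_coe, mem_filter, Fintype.mem_piFinset] at ha
    exact Fintype.mem_piFinset.2 fun i => ha.1 i
  · intro a ha b hb hab
    rw [mem_coe, mem_filter] at ha hb
    have hne : ∀ i, i ≠ i₀ → a i = b i := fun i hi => congrFun hab ⟨i, hi⟩
    have h0 : ∑ i, u i * ((a i : ℤ) - b i) = 0 := by
      simp only [mul_sub, Finset.sum_sub_distrib, ha.2, hb.2, sub_zero]
    rw [Finset.sum_eq_single i₀ (fun i _ hi => by rw [hne i hi]; simp) (by simp)] at h0
    funext i
    by_cases hi : i = i₀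
    · subst hi
      have := (mul_eq_zero.1 h0).resolve_left hi₀
      omega
    · exact hne i hi

/-- There are `K` integers of the same size without short linear relations. -/
theorem exists_dissociated {K A : ℕ} (hK : 1 ≤ K) (hA : 2 ^ (10 * K) ≤ A) :
    ∃ a : Fin K → ℕ, (∀ i, A ≤ a i ∧ a i < 2 * A) ∧
      ∀ u : Fin K → ℤ, ∑ i, (u i).natAbs ≤ 8 * K → ∑ i, u i * (a i : ℤ) = 0 → u = 0 := by
  classical
  have hA0 : 0 < A := lt_of_lt_of_le (by positivity) hA
  let box := Fintype.piFinset fun _ : Fin K => Finset.Ico A (2 * A)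
  let bad := ((integerBall K (8 * K)).erase 0).biUnion
    fun u => box.filter fun a => ∑ i, u i * (a i : ℤ) = 0
  have hbox : box.card = A ^ K := by
    simp only [box]
    rw [Fintype.card_piFinset_const, Nat.card_Ico]
    simp [two_mul]
  have hbad : bad.card < box.card := by
    have h1 : bad.card ≤ ((integerBall K (8 * K)).erase 0).card * A ^ (K - 1) :=
      Finset.card_biUnion_le_card_mul _ _ _ fun u hu =>
        card_filter_sum_eq_zero_le A u (Finset.ne_of_mem_erase hu)
    -- Union bound over the forbidden relations: each excludes at most a fraction `1 / A` of the
    -- box.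
    have h2 : ((integerBall K (8 * K)).erase 0).card < A := by
      calc _ < (integerBall K (8 * K)).card :=
            Finset.card_erase_lt_of_mem ((mem_integerBall 0).2 (by simp))
        _ ≤ 2 ^ (8 * K) * 3 ^ K := card_integerBall_le _ _
        _ ≤ 2 ^ (8 * K) * 4 ^ K := by gcongr; norm_num
        _ = 2 ^ (10 * K) := by
            rw [show (4 : ℕ) = 2 ^ 2 by norm_num, ← pow_mul, ← pow_add]
            ring_nf
        _ ≤ A := hA
    calc bad.card ≤ _ := h1
      _ < A * A ^ (K - 1) := Nat.mul_lt_mul_of_pos_right h2 (by positivity)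
      _ = box.card := by rw [hbox, ← pow_succ']; congr 1; omega
  obtain ⟨a, ha, hab⟩ := Finset.exists_mem_notMem_of_card_lt_card hbad
  refine ⟨a, fun i => Finset.mem_Ico.1 (Fintype.mem_piFinset.1 ha i), fun u hu h0 => ?_⟩
  by_contra hne
  exact hab (Finset.mem_biUnion.2 ⟨u, Finset.mem_erase.2 ⟨hne, (mem_integerBall u).2 hu⟩,
    Finset.mem_filter.2 ⟨ha, h0⟩⟩)

end Dissociated

/-! ### Construction of a detecting string -/

section Detector

open Finset

/-- The signed support pattern of an integer vector, labelled by `f`. -/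
def patternLabel {K : ℕ} (f : Finset (Fin K) → ℕ) (u : Fin K → ℤ) : ℕ :=
  if ∀ i, 0 ≤ u i then f (Finset.univ.filter fun i => 0 < u i) else 0

theorem patternLabel_congr {K : ℕ} (f : Finset (Fin K) → ℕ) {u v : Fin K → ℤ}
    (h₀ : ∀ i, 0 ≤ u i ↔ 0 ≤ v i) (h₁ : ∀ i, 0 < u i ↔ 0 < v i) :
    patternLabel f u = patternLabel f v := by
  simp only [patternLabel, h₀, h₁]

theorem patternLabel_nonneg {K : ℕ} (f : Finset (Fin K) → ℕ) {u : Fin K → ℤ}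
    (h : patternLabel f u ≠ 0) (i : Fin K) : 0 ≤ u i := by
  by_contra hi
  exact h (if_neg fun hu => hi (hu i))

open Classical in
/-- The symbol at position `t`: the pattern label of the short representation of `t` as an integer
combination of the `a i`, if there is one. -/
noncomputable def representationLabel {K : ℕ} (f : Finset (Fin K) → ℕ) (a : Fin K → ℕ) (t : ℕ) :
    ℕ :=
  if h : ∃ u : Fin K → ℤ, ∑ i, (u i).natAbs ≤ 4 * K ∧ ∑ i, u i * (a i : ℤ) = t then
    patternLabel f h.choose else 0

theorem representationLabel_lt {K : ℕ} {f : Finset (Fin K) → ℕ} {p : ℕ} (hf : ∀ ε, f ε < p)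
    (a : Fin K → ℕ) (t : ℕ) : representationLabel f a t < p := by
  have hp : 0 < p := lt_of_le_of_lt (Nat.zero_le _) (hf ∅)
  unfold representationLabel patternLabel
  split_ifs <;> first | exact hf _ | exact hp

/-- Two representations of norm at most `4 * K` differ by a relation of norm at most `8 * K`, so the
chosen one is the given one. -/
theorem representationLabel_eq {K : ℕ} (f : Finset (Fin K) → ℕ) {a : Fin K → ℕ}
    (ha : ∀ u : Fin K → ℤ, ∑ i, (u i).natAbs ≤ 8 * K → ∑ i, u i * (a i : ℤ) = 0 → u = 0)
    {u : Fin K → ℤ} {t : ℕ} (hu : ∑ i, (u i).natAbs ≤ 4 * K) (ht : ∑ i, u i * (a i : ℤ) = t) :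
    representationLabel f a t = patternLabel f u := by
  have h : ∃ u : Fin K → ℤ, ∑ i, (u i).natAbs ≤ 4 * K ∧ ∑ i, u i * (a i : ℤ) = t := ⟨u, hu, ht⟩
  rw [representationLabel, dif_pos h]
  congr 1
  rw [← sub_eq_zero]
  refine ha _ ?_ ?_
  · calc ∑ i, ((h.choose - u) i).natAbs ≤ ∑ i, ((h.choose i).natAbs + (u i).natAbs) :=
          Finset.sum_le_sum fun i _ => Int.natAbs_sub_le _ _
      _ ≤ 4 * K + 4 * K := by
          rw [Finset.sum_add_distrib]
          exact add_le_add h.choose_spec.1 hu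
      _ = 8 * K := by ring
  · simp only [Pi.sub_apply, sub_mul, Finset.sum_sub_distrib, h.choose_spec.2, ht, sub_self]

/-- The indicator vector of a set of coordinates. -/
def cubeVertex {K : ℕ} (ε : Finset (Fin K)) (i : Fin K) : ℤ := if i ∈ ε then 1 else 0

theorem sum_cubeVertex_mul {K : ℕ} (ε : Finset (Fin K)) (a : Fin K → ℕ) :
    ∑ i, cubeVertex ε i * (a i : ℤ) = ((∑ i ∈ ε, a i : ℕ) : ℤ) := by
  simp [cubeVertex, Finset.sum_ite_mem]

theorem cubeVertex_natAbs_le {K : ℕ} (ε : Finset (Fin K)) (i : Fin K) :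
    (cubeVertex ε i).natAbs ≤ 1 := by
  unfold cubeVertex
  split_ifs <;> simp

theorem sum_natAbs_le_of_sum_mul_lt {K A N : ℕ} {a : Fin K → ℕ} (hA : ∀ i, A ≤ a i)
    {u : Fin K → ℤ} (hu : ∀ i, 0 ≤ u i) (hsum : ∑ i, u i * (a i : ℤ) < N * A) :
    ∑ i, (u i).natAbs ≤ N := by
  have h1 : ((∑ i, (u i).natAbs : ℕ) : ℤ) * A ≤ ∑ i, u i * (a i : ℤ) := by
    rw [Nat.cast_sum, Finset.sum_mul]
    refine Finset.sum_le_sum fun i _ => ?_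
    rw [Int.natCast_natAbs, abs_of_nonneg (hu i)]
    exact mul_le_mul_of_nonneg_left (by exact_mod_cast hA i) (hu i)
  have h2 : ((∑ i, (u i).natAbs : ℕ) : ℤ) < N :=
    lt_of_mul_lt_mul_right (lt_of_le_of_lt h1 hsum) (by positivity)
  omega

theorem sum_le_of_lt_two_mul {K A : ℕ} {a : Fin K → ℕ} (hA : ∀ i, a i < 2 * A)
    (ε : Finset (Fin K)) : ∑ i ∈ ε, a i ≤ K * (2 * A) := by
  calc ∑ i ∈ ε, a i ≤ ε.card * (2 * A) := by
        rw [← smul_eq_mul]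
        exact Finset.sum_le_card_nsmul _ _ _ fun i _ => (hA i).le
    _ ≤ K * (2 * A) :=
        Nat.mul_le_mul_right _ ((Finset.card_le_univ _).trans_eq (Fintype.card_fin K))

/-- Away from the origin, the labels on a translate of the cube do not depend on some
coordinate. -/
theorem representationLabel_insert {K A : ℕ} (hK : 1 ≤ K) (f : Finset (Fin K) → ℕ)
    {a : Fin K → ℕ} (hA : ∀ i, A ≤ a i ∧ a i < 2 * A)
    (ha : ∀ u : Fin K → ℤ, ∑ i, (u i).natAbs ≤ 8 * K → ∑ i, u i * (a i : ℤ) = 0 → u = 0)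
    {j : ℕ} (hj : 0 < j) (hjA : j < K * A) :
    ∃ i, ∀ ε : Finset (Fin K), i ∉ ε →
      representationLabel f a (j + ∑ l ∈ insert i ε, a l) =
        representationLabel f a (j + ∑ l ∈ ε, a l) := by
  by_cases hall : ∀ ε : Finset (Fin K), representationLabel f a (j + ∑ l ∈ ε, a l) = 0
  · exact ⟨⟨0, hK⟩, fun ε _ => by rw [hall, hall]⟩
  push Not at hall
  obtain ⟨ε₀, hε₀⟩ := hall
  obtain ⟨v, hv, hva⟩ : ∃ v : Fin K → ℤ, ∑ i, (v i).natAbs ≤ 4 * K ∧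
      ∑ i, v i * (a i : ℤ) = (j + ∑ l ∈ ε₀, a l : ℕ) := by
    by_contra h
    exact hε₀ (dif_neg h)
  rw [representationLabel_eq f ha hv hva] at hε₀
  -- A nonzero label forces nonnegative coefficients; as every `a i` is at least `A`, the size of
  -- the represented number then bounds the norm by `3 * K`, leaving `K` to spare for moving to
  -- other vertices.
  have hv0 := patternLabel_nonneg f hε₀
  have hv3 : ∑ i, (v i).natAbs ≤ 3 * K := by
    refine sum_natAbs_le_of_sum_mul_lt (fun i => (hA i).1) hv0 ?_
    rw [hva]
    have h1 := sum_le_of_lt_two_mul (fun i => (hA i).2) ε₀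
    have h2 : j + ∑ l ∈ ε₀, a l < 3 * K * A := by
      calc j + ∑ l ∈ ε₀, a l < K * A + K * (2 * A) := add_lt_add_of_lt_of_le hjA h1
        _ = 3 * K * A := by ring
    exact_mod_cast h2
  have hshift : ∀ ε : Finset (Fin K), representationLabel f a (j + ∑ l ∈ ε, a l) =
      patternLabel f (fun i => v i - cubeVertex ε₀ i + cubeVertex ε i) := by
    intro ε
    refine representationLabel_eq f ha ?_ ?_
    · calc ∑ i, (v i - cubeVertex ε₀ i + cubeVertex ε i).natAbs
          ≤ ∑ i, ((v i).natAbs + 1) := by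
            refine Finset.sum_le_sum fun i _ => ?_
            unfold cubeVertex
            split_ifs <;> omega
        _ ≤ 4 * K := by
            rw [Finset.sum_add_distrib]
            simp
            omega
    · simp only [add_mul, sub_mul, Finset.sum_add_distrib, Finset.sum_sub_distrib,
        sum_cubeVertex_mul, hva]
      push_cast
      ring
  -- The vector `v - cubeVertex ε₀` represents `j > 0`, so some coefficient is positive. Adding 0 or
  -- 1 to it does not alter the sign pattern.
  obtain ⟨i, hi⟩ : ∃ i, 0 < v i - cubeVertex ε₀ i := by
    by_contra h
    push Not at h
    have h1 : ∑ i, (v i - cubeVertex ε₀ i) * (a i : ℤ) ≤ 0 :=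
      Finset.sum_nonpos fun i _ => mul_nonpos_of_nonpos_of_nonneg (h i) (by positivity)
    simp only [sub_mul, Finset.sum_sub_distrib, sum_cubeVertex_mul, hva] at h1
    push_cast at h1
    omega
  refine ⟨i, fun ε hε => ?_⟩
  rw [hshift, hshift]
  have hne : ∀ l, l ≠ i → cubeVertex (insert i ε) l = cubeVertex ε l := by
    intro l hl
    simp [cubeVertex, hl]
  refine patternLabel_congr f (fun l => ?_) (fun l => ?_)
  all_goals
    by_cases hl : l = i
    · subst hl
      simp only [cubeVertex, hε, Finset.mem_insert_self, if_true, if_false]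
      simp only [cubeVertex] at hi
      omega
    · rw [hne l hl]

/-- `g` is a string of symbols below `p` in which, by integer combinations of its shifts by less
than `T`, the symbol at position `0` is recovered from an overlay of shifts by less than `M`. -/
def Detects (p M T : ℕ) (g : ℕ → ℕ) : Prop :=
  ∃ (K : ℕ) (e : Finset (Fin K) → ℕ), (∀ ε, e ε + M ≤ T) ∧
    (∀ s j, 0 < j → j < M → alternatingCount (fun ε => g (j + e ε)) s = 0) ∧
    Set.InjOn (alternatingCount fun ε => g (e ε)) (Set.Iio p)

/-- The cube has dimension `K = 2 * κ`. Subset sums are at most `K * (2 * A)`, and adding the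
overlay length `K * A` gives `6 * κ * A`. -/
theorem exists_detects {κ A : ℕ} (hκ : 1 ≤ κ) (hA : 2 ^ (20 * κ) ≤ A) :
    ∃ g : ℕ → ℕ, (∀ t, g t < 2 ^ κ) ∧ Detects (2 ^ κ) (2 * κ * A) (6 * κ * A) g := by
  obtain ⟨f, hf, hinj⟩ := exists_cube_labelling hκ
  obtain ⟨a, haA, ha⟩ := exists_dissociated (K := 2 * κ) (A := A) (by omega)
    (by rwa [← mul_assoc])
  refine ⟨representationLabel f a, representationLabel_lt hf a, 2 * κ,
    fun ε => ∑ i ∈ ε, a i, fun ε => ?_, fun s j hj hjM => ?_, ?_⟩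
  · calc ∑ i ∈ ε, a i + 2 * κ * A ≤ (2 * κ) * (2 * A) + 2 * κ * A := by
          gcongr
          exact sum_le_of_lt_two_mul (fun i => (haA i).2) ε
      _ = 6 * κ * A := by ring
  · obtain ⟨i, hi⟩ := representationLabel_insert (by omega) f haA ha hj hjM
    exact alternatingCount_eq_zero _ i hi s
  · have hlabel : (fun ε => representationLabel f a (∑ i ∈ ε, a i)) = f := by
      funext ε
      rw [representationLabel_eq f ha (u := cubeVertex ε) _ (sum_cubeVertex_mul ε a)]
      · rw [patternLabel, if_pos fun i => by unfold cubeVertex; split_ifs <;> simp]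
        have hsupp : (Finset.univ.filter fun i => 0 < cubeVertex ε i) = ε := by
          ext i
          rw [Finset.mem_filter]
          by_cases h : i ∈ ε <;> simp [cubeVertex, h]
        rw [hsupp]
      · calc ∑ i, (cubeVertex ε i).natAbs ≤ ∑ _i : Fin (2 * κ), 1 :=
              Finset.sum_le_sum fun i _ => cubeVertex_natAbs_le ε i
          _ ≤ 4 * (2 * κ) := by simp; omega
    rw [hlabel]
    exact hinj

end Detector

/-! ### Decoding symbols from Hamming distances -/

section Strings

open Finset

theorem foldl_shiftIn_apply {n : ℕ} {α : Type} (S₀ : Fin n → α) (l : List α) (hl : l.length ≤ n)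
    (i : Fin n) :
    l.foldl shiftIn S₀ i = if h : i.val + l.length < n then S₀ ⟨i.val + l.length, h⟩
      else l[i.val + l.length - n]'(by omega) := by
  induction l using List.reverseRecOn generalizing i with
  | nil => simp
  | append_singleton l x ih =>
    simp only [List.length_append, List.length_singleton] at hl
    simp only [List.foldl_append, List.foldl_cons, List.foldl_nil, List.length_append,
      List.length_singleton]
    rw [shiftIn]
    by_cases h1 : i.val + 1 < n
    · rw [dif_pos h1, ih (by omega)]
      by_cases h2 : i.val + (l.length + 1) < n
      · rw [dif_pos (by simp only; omega), dif_pos h2]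
        congr 2
        simp only
        omega
      · rw [dif_neg (by simp only; omega), dif_neg h2, List.getElem_append_left (by omega)]
        congr 1
        simp only
        omega
    · rw [dif_neg h1, dif_neg (by omega), List.getElem_append_right (by omega)]
      simp

/-- The maintained string after the arrivals of the symbols of `U` up to time `t`. -/
def window {n : ℕ} {α : Type} (S₀ U : Fin n → α) (t : ℕ) : Fin n → α :=
  ((List.ofFn U).take (t + 1)).foldl shiftIn S₀

theorem window_apply {n : ℕ} {α : Type} (S₀ U : Fin n → α) {t : ℕ} (ht : t < n) (i : Fin n) :
    window S₀ U t i = if h : i.val + (t + 1) < n then S₀ ⟨i.val + (t + 1), h⟩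
      else U ⟨i.val + (t + 1) - n, by omega⟩ := by
  have hlen : ((List.ofFn U).take (t + 1)).length = t + 1 := by
    simp
    omega
  rw [window, foldl_shiftIn_apply _ _ (by omega)]
  simp only [hlen]
  split_ifs
  · rfl
  · simp

theorem hammingDist_cast {n : ℕ} {α : Type} [DecidableEq α] (F S : Fin n → α) :
    (hammingDist F S : ℤ) = ∑ i, (1 - if F i = S i then 1 else 0) := by
  rw [hammingDist, Finset.card_filter]
  push_cast
  refine Finset.sum_congr rfl fun i _ => ?_
  by_cases h : F i = S i <;> simp [h]

/-- The difference of two answers, as a sum over the arrival times. -/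
theorem hammingDist_window_sub {n q : ℕ} (G : ℕ → ℕ) (F : Fin n → Fin q)
    (hF : ∀ i, (F i : ℕ) = G (n - 1 - i)) (S₀ U V : Fin n → Fin q) {t : ℕ} (ht : t < n) :
    (hammingDist F (window S₀ U t) : ℤ) - hammingDist F (window S₀ V t) =
      ∑ s : Fin n, if s.val ≤ t then
        (if G (t - s) = V s then 1 else 0) - (if G (t - s) = U s then 1 else 0) else 0 := by
  rw [hammingDist_cast, hammingDist_cast, ← Finset.sum_sub_distrib, ← Finset.sum_filter]
  -- Positions still occupied by `S₀` contribute equally to both distances; the others correspond to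
  -- arrival times `s ≤ t`.
  rw [← Finset.sum_filter_add_sum_filter_not _ (fun i : Fin n => i.val + (t + 1) < n),
    Finset.sum_eq_zero, zero_add]
  · refine Finset.sum_bij' (fun i _ => ⟨i.val + (t + 1) - n, by omega⟩)
      (fun s hs => ⟨s.val + n - (t + 1), by simp at hs; omega⟩) ?_ ?_ ?_ ?_ ?_
    · intro i hi
      simp only [mem_filter, mem_univ, true_and] at hi ⊢
      omega
    · intro s hs
      simp only [mem_filter, mem_univ, true_and] at hs ⊢
      omega
    · intro i hi
      simp only [mem_filter, mem_univ, true_and] at hi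
      ext
      simp only
      omega
    · intro s hs
      simp only [mem_filter, mem_univ, true_and] at hs
      ext
      simp only
      omega
    · intro i hi
      simp only [mem_filter, mem_univ, true_and] at hi
      rw [window_apply _ _ ht, window_apply _ _ ht, dif_neg hi, dif_neg hi]
      simp only [Fin.ext_iff, hF]
      rw [show t - (i.val + (t + 1) - n) = n - 1 - i by omega]
      ring
  · intro i hi
    simp only [mem_filter, mem_univ, true_and] at hi
    rw [window_apply _ _ ht, window_apply _ _ ht, dif_pos hi, dif_pos hi, sub_self]

/-- If the fixed string contains a detecting string `g` at distance `j₀` from its right end, then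
the answers determine the symbols that arrive in a time interval of length `M`. -/
theorem eq_of_hammingDist_window_eq {n q p M T j₀ lo : ℕ} {g G : ℕ → ℕ} (hg : Detects p M T g)
    (hG : ∀ j < T, G (j₀ + j) = g j) (F : Fin n → Fin q)
    (hF : ∀ i, (F i : ℕ) = G (n - 1 - i)) (S₀ U V : Fin n → Fin q)
    (hU : ∀ s, (U s : ℕ) < p) (hV : ∀ s, (V s : ℕ) < p)
    (hUV : ∀ s : Fin n, ¬(lo ≤ s.val ∧ s.val < lo + M) → U s = V s)
    (hn : lo + j₀ + T ≤ n)
    (hD : ∀ t, lo + j₀ ≤ t → t < lo + j₀ + T →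
      hammingDist F (window S₀ U t) = hammingDist F (window S₀ V t)) : U = V := by
  obtain ⟨K, e, heT, hzero, hinj⟩ := hg
  by_contra hne
  obtain ⟨s₁, hs₁⟩ := Function.ne_iff.1 hne
  let B := Finset.univ.filter fun s => U s ≠ V s
  have hB : B.Nonempty := ⟨s₁, by simp [B, hs₁]⟩
  -- With `z` the last disagreement, only shifts `z - s ≥ 0` matter, and shift 0 belongs to `z`
  -- alone.
  obtain ⟨z, hzB, hmax⟩ := B.exists_max_image (fun s => s.val) hB
  have hz : U z ≠ V z := by simpa [B] using hzB
  have hafter : ∀ s : Fin n, z.val < s.val → U s = V s := by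
    intro s hs
    by_contra h
    have := hmax s (by simp [B, h])
    omega
  have hzr : lo ≤ z.val ∧ z.val < lo + M := by
    by_contra h
    exact hz (hUV z h)
  have hterm : ∀ (ε : Finset (Fin K)) (s : Fin n),
      (if s.val ≤ z.val + j₀ + e ε then
        ((if G (z.val + j₀ + e ε - s) = V s then 1 else 0) -
          (if G (z.val + j₀ + e ε - s) = U s then 1 else 0) : ℤ) else 0) =
      if lo ≤ s.val ∧ s.val ≤ z.val then
        (if g (z.val - s.val + e ε) = V s then 1 else 0) -
          (if g (z.val - s.val + e ε) = U s then 1 else 0) else 0 := by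
    intro ε s
    have := heT ε
    by_cases h1 : lo ≤ s.val ∧ s.val ≤ z.val
    · rw [if_pos h1, if_pos (by omega),
        show z.val + j₀ + e ε - s = j₀ + (z.val - s.val + e ε) by omega, hG _ (by omega)]
    · rw [if_neg h1]
      have : U s = V s := by
        by_cases h2 : lo ≤ s.val
        · exact hafter s (by omega)
        · exact hUV s (by omega)
      rw [this, sub_self, ite_self]
  have hΔ : ∀ ε : Finset (Fin K), ∑ s : Fin n, (if lo ≤ s.val ∧ s.val ≤ z.val then
        (if g (z.val - s.val + e ε) = V s then 1 else 0) -
          (if g (z.val - s.val + e ε) = U s then 1 else 0) else 0 : ℤ) = 0 := by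
    intro ε
    have := heT ε
    have ht : z.val + j₀ + e ε < n := by omega
    rw [← Finset.sum_congr rfl fun s _ => hterm ε s, ← hammingDist_window_sub G F hF S₀ U V ht,
      hD _ (by omega) (by omega), sub_self]
  -- The alternating sum over `ε` kills all terms with `s < z`, leaving equal alternating counts for
  -- `U z` and `V z`.
  have hsum : ∑ s : Fin n, (if lo ≤ s.val ∧ s.val ≤ z.val then
      alternatingCount (fun ε => g (z.val - s.val + e ε)) (V s) -
        alternatingCount (fun ε => g (z.val - s.val + e ε)) (U s) else 0) = 0 := by
    calc _ = ∑ ε : Finset (Fin K), (-1 : ℤ) ^ ε.card *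
          ∑ s : Fin n, (if lo ≤ s.val ∧ s.val ≤ z.val then
            (if g (z.val - s.val + e ε) = V s then 1 else 0) -
              (if g (z.val - s.val + e ε) = U s then 1 else 0) else 0 : ℤ) := by
          simp only [Finset.mul_sum]
          rw [Finset.sum_comm]
          refine Finset.sum_congr rfl fun s _ => ?_
          split_ifs
          · rw [alternatingCount, alternatingCount, ← Finset.sum_sub_distrib]
            exact Finset.sum_congr rfl fun ε _ => (mul_sub _ _ _).symm
          · simp
      _ = 0 := Finset.sum_eq_zero fun ε _ => by rw [hΔ, mul_zero]
  rw [Finset.sum_eq_single z, if_pos ⟨hzr.1, le_rfl⟩] at hsum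
  · simp only [Nat.sub_self, Nat.zero_add] at hsum
    exact hz (Fin.ext (hinj (hV z) (hU z) (sub_eq_zero.1 hsum)).symm)
  · intro s _ hs
    split_ifs with h
    · have : s.val ≠ z.val := fun h => hs (Fin.ext h)
      rw [hzero _ _ (by omega) (by omega), hzero _ _ (by omega) (by omega), sub_self]
    · rfl
  · simp

end Strings

/-! ### Entropy bound for encodings by partial functions -/

section Counting

open Finset

/-- The weighted number of partial functions. -/
theorem sum_partialFunction_weight_le (X : Type) [Fintype X] [DecidableEq X] [Nonempty X] :
    ∑ c : X → Option X, ∏ x, (if (c x).isSome then ((Fintype.card X : ℝ) ^ 2)⁻¹ else 1) ≤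
      Real.exp 1 := by
  have hN : (0 : ℝ) < Fintype.card X := by exact_mod_cast Fintype.card_pos
  have h1 : ∑ c : X → Option X, ∏ x, (if (c x).isSome then ((Fintype.card X : ℝ) ^ 2)⁻¹ else 1) =
      ∏ _x : X, ∑ o : Option X, (if o.isSome then ((Fintype.card X : ℝ) ^ 2)⁻¹ else 1) := by
    rw [Finset.prod_univ_sum, Fintype.piFinset_univ]
  rw [h1, Finset.prod_const, Finset.card_univ, Fintype.sum_option]
  simp only [Option.isSome_none, Option.isSome_some, if_true, Finset.sum_const, Finset.card_univ,
    nsmul_eq_mul, Bool.false_eq_true, if_false]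
  rw [pow_two, mul_inv, ← mul_assoc, mul_inv_cancel₀ hN.ne', one_mul]
  calc (1 + (Fintype.card X : ℝ)⁻¹) ^ Fintype.card X
      ≤ Real.exp ((Fintype.card X : ℝ)⁻¹) ^ Fintype.card X := by
        gcongr
        rw [add_comm]
        exact Real.add_one_le_exp _
    _ = Real.exp 1 := by rw [← Real.exp_nat_mul, mul_inv_cancel₀ hN.ne']

/-- If elements of `Ω` are determined by their image under `r` together with a partial function,
then the average size of the domain of the partial function is large. -/
theorem le_sum_card_of_encoding {X β γ : Type} [Fintype X] [DecidableEq X] [Nonempty X]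
    [DecidableEq γ] (Ω : Finset β) (r : β → γ) (f : β → X → Option X)
    (hinj : ∀ U ∈ Ω, ∀ V ∈ Ω, r U = r V → f U = f V → U = V) {Q : ℝ} (hQ : 0 < Q)
    (hΩ : Q * (Ω.image r).card ≤ Ω.card) :
    Ω.card * (Real.log Q - 2) ≤ 2 * Real.log (Fintype.card X) *
      ∑ U ∈ Ω, ((Finset.univ.filter fun x => (f U x).isSome).card : ℝ) := by
  classical
  have hN : (0 : ℝ) < Fintype.card X := by exact_mod_cast Fintype.card_pos
  let φ : (X → Option X) → ℝ :=
    fun c => ∏ x, (if (c x).isSome then ((Fintype.card X : ℝ) ^ 2)⁻¹ else 1)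
  have hφ0 : ∀ c, 0 ≤ φ c := fun c => Finset.prod_nonneg fun x _ => by split_ifs <;> positivity
  have hφ : ∀ c, φ c = Real.exp (-(2 * Real.log (Fintype.card X) *
      ((Finset.univ.filter fun x => (c x).isSome).card : ℝ))) := by
    intro c
    simp only [φ]
    rw [Finset.prod_ite, Finset.prod_const, Finset.prod_const_one, mul_one,
      ← Real.exp_log (inv_pos.2 (pow_pos hN 2)), ← Real.exp_nat_mul, Real.log_inv, Real.log_pow]
    congr 1
    push_cast
    ring
  -- A Kraft inequality: each cell of the domain costs a factor `(card X) ^ 2`, for its address and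
  -- its content.
  have hsum : ∑ U ∈ Ω, φ (f U) ≤ (Ω.image r).card * Real.exp 1 := by
    have hinj' : Set.InjOn (fun U => (r U, f U)) Ω := fun U hU V hV h =>
      hinj U hU V hV (Prod.ext_iff.1 h).1 (Prod.ext_iff.1 h).2
    calc ∑ U ∈ Ω, φ (f U) = ∑ x ∈ Ω.image fun U => (r U, f U), φ x.2 :=
          (Finset.sum_image (f := fun x : γ × (X → Option X) => φ x.2) hinj').symm
      _ ≤ ∑ x ∈ Ω.image r ×ˢ Finset.univ, φ x.2 := by
          refine Finset.sum_le_sum_of_subset_of_nonneg ?_ fun _ _ _ => hφ0 _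
          intro x hx
          obtain ⟨U, hU, rfl⟩ := Finset.mem_image.1 hx
          exact Finset.mem_product.2 ⟨Finset.mem_image_of_mem r hU, Finset.mem_univ _⟩
      _ = (Ω.image r).card * ∑ c, φ c := by
          rw [Finset.sum_product]
          simp only [Finset.sum_const, nsmul_eq_mul]
      _ ≤ _ := by
          gcongr
          exact sum_partialFunction_weight_le X
  -- The tangent line bound `1 + x ≤ exp x` plays the role of Jensen's inequality. Together with `e
  -- < 3` it yields the loss of 2.
  have hlow : ∑ U ∈ Ω, (1 + Real.log Q - 2 * Real.log (Fintype.card X) *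
      ((Finset.univ.filter fun x => (f U x).isSome).card : ℝ)) ≤ ∑ U ∈ Ω, Q * φ (f U) := by
    refine Finset.sum_le_sum fun U _ => ?_
    rw [hφ, ← Real.exp_log hQ, ← Real.exp_add, Real.exp_log hQ]
    have := Real.add_one_le_exp (Real.log Q + -(2 * Real.log (Fintype.card X) *
      ((Finset.univ.filter fun x => (f U x).isSome).card : ℝ)))
    linarith
  rw [← Finset.mul_sum, Finset.sum_sub_distrib, Finset.sum_const, nsmul_eq_mul,
    ← Finset.mul_sum] at hlow
  have h3 : Q * ∑ U ∈ Ω, φ (f U) ≤ Ω.card * 3 := by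
    calc Q * ∑ U ∈ Ω, φ (f U) ≤ Q * ((Ω.image r).card * Real.exp 1) := by gcongr
      _ = Q * (Ω.image r).card * Real.exp 1 := by ring
      _ ≤ Ω.card * 3 := by
          gcongr
          exact (Real.exp_one_lt_d9.trans (by norm_num)).le
  linarith

theorem card_subtype_interval {n lo M : ℕ} (h : lo + M ≤ n) :
    Fintype.card {s : Fin n // lo ≤ s.val ∧ s.val < lo + M} = M := by
  refine Eq.trans (Fintype.card_congr (β := Fin M) ?_) (Fintype.card_fin M)
  exact
    { toFun := fun s => ⟨s.1.val - lo, by have := s.2; omega⟩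
      invFun := fun i => ⟨⟨lo + i.val, by omega⟩, by simp⟩
      left_inv := fun s => by
        have := s.2
        ext
        simp only
        omega
      right_inv := fun i => by ext; simp }

/-- The strings all of whose symbols lie in `S`. -/
def stringsOver {n : ℕ} {α : Type} [DecidableEq α] (S : Finset α) : Finset (Fin n → α) :=
  Fintype.piFinset fun _ => S

/-- Forgetting `M` positions merges strings by a factor `S.card ^ M`; this supplies `Q` in
`le_sum_card_of_encoding`. -/
theorem card_image_restrict_le {n lo M : ℕ} {α : Type} [DecidableEq α] (h : lo + M ≤ n)
    (S : Finset α) :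
    S.card ^ M * ((stringsOver (n := n) S).image fun U =>
      fun s : {s : Fin n // ¬(lo ≤ s.val ∧ s.val < lo + M)} => U s).card ≤
        (stringsOver (n := n) S).card := by
  have h1 : ((stringsOver (n := n) S).image fun U =>
      fun s : {s : Fin n // ¬(lo ≤ s.val ∧ s.val < lo + M)} => U s) ⊆
        Fintype.piFinset fun _ => S := by
    intro x hx
    obtain ⟨U, hU, rfl⟩ := Finset.mem_image.1 hx
    exact Fintype.mem_piFinset.2 fun s => Fintype.mem_piFinset.1 hU s
  have h2 := Finset.card_le_card h1
  rw [Fintype.card_piFinset, Finset.prod_const, Finset.card_univ, Fintype.card_subtype_compl,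
    card_subtype_interval h, Fintype.card_fin] at h2
  have h3 : (stringsOver (n := n) S).card = S.card ^ M * S.card ^ (n - M) := by
    rw [stringsOver, Fintype.card_piFinset_const, ← pow_add]
    congr 1
    omega
  rw [h3]
  exact Nat.mul_le_mul_left _ h2

end Counting

/-! ### Lower bound for the information transfer at one scale, and the multiscale string -/

section Transfer

open Finset

theorem expectedInfoTransfer_uniform {w n : ℕ} {α : Type} [Fintype α] (A : Algorithm w α)
    (Ω : Finset (Fin n → α)) (hΩ : Ω.Nonempty) (t₀ t₁ t₂ : ℕ) :
    Ω.card * expectedInfoTransfer A (PMF.uniformOfFinset Ω hΩ) t₀ t₁ t₂ =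
      ∑ U ∈ Ω, ((A.infoTransfer (List.ofFn U) t₀ t₁ t₂).card : ℝ) := by
  classical
  have h0 : (Ω.card : ℝ) ≠ 0 := by exact_mod_cast hΩ.card_pos.ne'
  rw [expectedInfoTransfer, Finset.mul_sum]
  rw [← Finset.sum_subset (Finset.subset_univ Ω)]
  · refine Finset.sum_congr rfl fun U hU => ?_
    rw [PMF.uniformOfFinset_apply_of_mem hΩ hU, ENNReal.toReal_inv, ENNReal.toReal_natCast,
      ← mul_assoc, mul_inv_cancel₀ h0, one_mul]
  · intro U _ hU
    rw [PMF.uniformOfFinset_apply_of_notMem hΩ hU]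
    simp

theorem take_drop_ofFn_congr {n : ℕ} {α : Type} {U V : Fin n → α} {a b : ℕ}
    (h : ∀ s : Fin n, a ≤ s.val → s.val < b → U s = V s) :
    ((List.ofFn U).take b).drop a = ((List.ofFn V).take b).drop a := by
  refine List.ext_getElem (by simp) fun i h₁ h₂ => ?_
  simp only [List.length_drop, List.length_take, List.length_ofFn] at h₁
  simp only [List.getElem_drop, List.getElem_take, List.getElem_ofFn]
  exact h _ (by simp) (by simp only; omega)

theorem card_domain_transferContents {w : ℕ} {α : Type} (A : Algorithm w α) (U : List α)
    (t₀ t₁ t₂ : ℕ) :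
    (Finset.univ.filter fun c => (A.transferContents U t₀ t₁ t₂ c).isSome) =
      A.infoTransfer U t₀ t₁ t₂ := by
  ext c
  by_cases h : c ∈ A.infoTransfer U t₀ t₁ t₂ <;> simp [Algorithm.transferContents, h]

theorem hammingDist_window_eq_answer {w n : ℕ} {α : Type} [DecidableEq α] {A : Algorithm w α}
    {F S₀ : Fin n → α} (hA : SolvesOnlineHamming A F S₀) (U : Fin n → α) {t : ℕ} (ht : t < n) :
    hammingDist F (window S₀ U t) = A.answer ((List.ofFn U).take t) (U ⟨t, ht⟩) := by
  rw [hA, window, List.take_succ_eq_append_getElem (by simpa using ht), List.foldl_append]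
  simp

/-- The answers during the second interval agree if the information transfers agree. -/
theorem hammingDist_window_eq_of_transferContents_eq {w n : ℕ} {α : Type} [DecidableEq α]
    {A : Algorithm w α} {F S₀ : Fin n → α} (hA : SolvesOnlineHamming A F S₀) {U V : Fin n → α}
    {t₀ t₁ t₂ : ℕ} (h01 : t₀ ≤ t₁ + 1) (h2 : t₂ < n)
    (hUV : ∀ s : Fin n, s.val < t₀ ∨ t₁ < s.val → U s = V s)
    (hcode : A.transferContents (List.ofFn U) t₀ t₁ t₂ =
      A.transferContents (List.ofFn V) t₀ t₁ t₂) {t : ℕ} (h1t : t₁ < t) (ht2 : t ≤ t₂) :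
    hammingDist F (window S₀ U t) = hammingDist F (window S₀ V t) := by
  have htn : t < n := by omega
  have hsplit : ∀ W : Fin n → α, (List.ofFn W).take t =
      (List.ofFn W).take (t₁ + 1) ++ ((List.ofFn W).take t).drop (t₁ + 1) := by
    intro W
    conv_lhs => rw [← List.take_append_drop (t₁ + 1) ((List.ofFn W).take t)]
    rw [List.take_take, min_eq_left (by omega)]
  rw [hammingDist_window_eq_answer hA U htn, hammingDist_window_eq_answer hA V htn, hsplit U,
    hsplit V, ← take_drop_ofFn_congr (U := U) (V := V) fun s hs _ => hUV s (Or.inr hs),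
    ← hUV ⟨t, htn⟩ (Or.inr h1t)]
  refine A.answer_eq_of_transferContents_eq (List.ofFn U) (List.ofFn V) h01 ?_ ?_ hcode _ _
    (((List.ofFn U).take (t₂ + 1)).drop (t + 1)) ?_
  · have := take_drop_ofFn_congr (U := U) (V := V) (a := 0) (b := t₀)
      fun s _ hs => hUV s (Or.inl hs)
    simpa using this
  · exact take_drop_ofFn_congr fun s hs _ => hUV s (Or.inr hs)
  · refine List.ext_getElem ?_ fun i h₁ h₂ => ?_
    · simp
      omega
    · simp only [List.length_drop, List.length_take, List.length_ofFn] at h₁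
      simp only [List.getElem_append, List.getElem_cons, List.getElem_drop, List.getElem_take,
        List.getElem_ofFn, List.length_drop, List.length_take, List.length_ofFn]
      split_ifs with h3 h4
      · rfl
      · congr 2
        omega
      · congr 2
        omega

/-- If the fixed string contains a detecting string, then the information transfer between
adjacent intervals is large on average. -/
theorem expectedInfoTransfer_ge {w n q p M T j₀ : ℕ} {g G : ℕ → ℕ} (hp : 0 < p) (hpq : p ≤ q)
    (hg : Detects p M T g) (hG : ∀ j < T, G (j₀ + j) = g j) (F : Fin n → Fin q)
    (hF : ∀ i, (F i : ℕ) = G (n - 1 - i)) {S₀ : Fin n → Fin q} {A : Algorithm w (Fin q)}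
    (hA : SolvesOnlineHamming A F S₀) (hΩ : (stringsOver (n := n)
      (Finset.univ.filter fun x : Fin q => x.val < p)).Nonempty) {t₀ t₁ t₂ : ℕ}
    (h01 : t₀ + j₀ ≤ t₁ + 1) (hMj : M ≤ j₀) (h12 : t₁ + T ≤ t₂) (h2 : t₂ < n) :
    M * Real.log p - 2 ≤ 2 * (w * Real.log 2) *
      expectedInfoTransfer A (PMF.uniformOfFinset _ hΩ) t₀ t₁ t₂ := by
  set S : Finset (Fin q) := Finset.univ.filter fun x : Fin q => x.val < p with hS
  have hScard : S.card = p := by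
    have := Fin.card_filter_val_lt (n := q) (m := p)
    rw [hS, this, min_eq_right hpq]
  have hmem : ∀ {U : Fin n → Fin q}, U ∈ stringsOver S → ∀ s, (U s : ℕ) < p := by
    intro U hU s
    simpa [hS] using Fintype.mem_piFinset.1 hU s
  -- The decoded block starts `j₀` before the second interval, so decoding begins at time `t₁ + 1`;
  -- the hypotheses on `j₀` and `M` keep the block inside the first interval.
  obtain ⟨lo, hlo⟩ : ∃ lo, lo + j₀ = t₁ + 1 := ⟨t₁ + 1 - j₀, by omega⟩
  have hQ : (0 : ℝ) < (p : ℝ) ^ M := by positivity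
  have key := le_sum_card_of_encoding (stringsOver (n := n) S)
    (fun U => fun s : {s : Fin n // ¬(lo ≤ s.val ∧ s.val < lo + M)} => U s)
    (fun U => A.transferContents (List.ofFn U) t₀ t₁ t₂) ?_ hQ ?_
  · simp only [card_domain_transferContents] at key
    rw [← expectedInfoTransfer_uniform A _ hΩ] at key
    have hpos : (0 : ℝ) < (stringsOver (n := n) S).card := by exact_mod_cast hΩ.card_pos
    refine le_of_mul_le_mul_left ?_ hpos
    have hcard : Real.log (Fintype.card (Word w)) = w * Real.log 2 := by
      simp
    rw [Real.log_pow, hcard] at key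
    calc _ ≤ _ := key
      _ = _ := by ring
  · intro U hU V hV hr hcode
    have hUV : ∀ s : Fin n, ¬(lo ≤ s.val ∧ s.val < lo + M) → U s = V s :=
      fun s hs => congrFun hr ⟨s, hs⟩
    refine eq_of_hammingDist_window_eq (lo := lo) hg hG F hF S₀ U V (hmem hU) (hmem hV) hUV
      (by omega) fun t hlt htl => ?_
    exact hammingDist_window_eq_of_transferContents_eq hA (by omega) h2
      (fun s hs => hUV s (by omega)) hcode (by omega) (by omega)
  · have := card_image_restrict_le (n := n) (lo := lo) (M := M) (by omega) S
    rw [hScard] at this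
    exact_mod_cast this

/-- A single string contains detecting strings at all sufficiently large dyadic scales. -/
theorem exists_multiscale_string {κ : ℕ} (hκ : 1 ≤ κ) :
    ∃ G : ℕ → ℕ, (∀ j, G j < 2 ^ κ) ∧ ∀ m A : ℕ, A = 2 ^ (m + 1) / (12 * κ) → 2 ^ (20 * κ) ≤ A →
      ∃ g : ℕ → ℕ, Detects (2 ^ κ) (2 * κ * A) (6 * κ * A) g ∧
        ∀ j < 6 * κ * A, G (2 ^ m + j) = g j := by
  have h : ∀ A : ℕ, ∃ g : ℕ → ℕ, (∀ t, g t < 2 ^ κ) ∧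
      (2 ^ (20 * κ) ≤ A → Detects (2 ^ κ) (2 * κ * A) (6 * κ * A) g) := by
    intro A
    by_cases hA : 2 ^ (20 * κ) ≤ A
    · obtain ⟨g, hg, hd⟩ := exists_detects hκ hA
      exact ⟨g, hg, fun _ => hd⟩
    · exact ⟨fun _ => 0, fun _ => by positivity, fun h => absurd h hA⟩
  choose g hlt hdet using h
  -- The detector for scale `m` starts at `2 ^ m` and has length at most `2 ^ m`, so different
  -- scales occupy disjoint dyadic blocks.
  refine ⟨fun j => g (2 ^ (Nat.log 2 j + 1) / (12 * κ)) (j - 2 ^ Nat.log 2 j),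
    fun j => hlt _ _, fun m A hA hA' => ⟨g A, hdet A hA', fun j hj => ?_⟩⟩
  have h1 : 12 * κ * A ≤ 2 ^ (m + 1) := by
    rw [hA]
    exact Nat.mul_div_le _ _
  have h2 : j < 2 ^ m := by
    have : 12 * κ * A = 2 * (6 * κ * A) := by ring
    rw [pow_succ] at h1
    omega
  have hlog : Nat.log 2 (2 ^ m + j) = m := by
    rw [Nat.log_eq_iff (Or.inr ⟨by norm_num, by positivity⟩), pow_succ]
    omega
  simp only [hlog, ← hA, Nat.add_sub_cancel_left]

end Transfer

end CellProbe

/-! ### Choice of constants -/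

theorem corollary2 :
    ∃ k : ℝ, 0 < k ∧ ∃ C : ℝ, 0 < C ∧
      ∀ δ n : ℕ, 1 ≤ δ → (2 ^ δ - 1) ^ 2 ≤ n →
        ∃ (F : Fin n → Fin (2 ^ δ)) (P : PMF (Fin n → Fin (2 ^ δ))),
          ∀ (w : ℕ), Real.logb 2 n ≤ w →
            ∀ (S₀ : Fin n → Fin (2 ^ δ)) (A : CellProbe.Algorithm w (Fin (2 ^ δ))),
              CellProbe.SolvesOnlineHamming A F S₀ →
                ∀ ℓ t₀ t₁ t₂ : ℕ, t₀ ≤ t₁ → t₁ < t₂ → t₂ < n →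
                  t₁ + 1 - t₀ = 2 ^ ℓ → t₂ - t₁ = 2 ^ ℓ →
                    k * Real.sqrt n ≤ (2 : ℝ) ^ ℓ →
                      C * ((δ : ℝ) / w * 2 ^ ℓ) ≤ CellProbe.expectedInfoTransfer A P t₀ t₁ t₂ := by
  refine ⟨2 ^ 25, by norm_num, 1 / 1152, by norm_num, fun δ n hδ hn => ?_⟩
  -- Only `2 ^ κ` symbols arrive, with `δ ≤ 24 * κ ≤ δ + 24`. The 24 pays for `2 ^ (20 * κ) ≤ a` and
  -- for `12 * κ ≤ 2 ^ (4 * κ)`.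
  obtain ⟨κ, hκ⟩ : ∃ κ, κ = δ / 24 + 1 := ⟨_, rfl⟩
  have hκ1 : 1 ≤ κ := by omega
  have hpq : 2 ^ κ ≤ 2 ^ δ := Nat.pow_le_pow_right (by norm_num) (by omega)
  obtain ⟨G, hG, hscale⟩ := CellProbe.exists_multiscale_string hκ1
  have hΩ : (CellProbe.stringsOver (n := n)
      (Finset.univ.filter fun x : Fin (2 ^ δ) => x.val < 2 ^ κ)).Nonempty :=
    ⟨fun _ => ⟨0, by positivity⟩, Fintype.mem_piFinset.2 fun _ => by simp⟩
  let F : Fin n → Fin (2 ^ δ) := fun i => ⟨G (n - 1 - i), (hG _).trans_le hpq⟩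
  refine ⟨F, PMF.uniformOfFinset _ hΩ, ?_⟩
  intro w _ S₀ A hA ℓ t₀ t₁ t₂ h01 h12 h2n hl1 hl2 hk
  have hlarge : 2 ^ (24 * κ) ≤ 2 ^ ℓ := by
    have h1 : ((2 : ℝ) ^ δ - 1) ≤ Real.sqrt n := by
      refine Real.le_sqrt_of_sq_le ?_
      have : (((2 ^ δ - 1) ^ 2 : ℕ) : ℝ) ≤ n := by exact_mod_cast hn
      rw [Nat.cast_pow, Nat.cast_sub Nat.one_le_two_pow] at this
      exact_mod_cast this
    have h2 : (2 : ℝ) ≤ 2 ^ δ := by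
      calc (2 : ℝ) = 2 ^ 1 := by norm_num
        _ ≤ 2 ^ δ := pow_le_pow_right₀ (by norm_num) hδ
    have h3 : (2 : ℝ) ^ (24 + δ) ≤ 2 ^ ℓ := by
      rw [pow_add]
      calc (2 : ℝ) ^ 24 * 2 ^ δ ≤ 2 ^ 25 * (2 ^ δ - 1) := by linarith
        _ ≤ 2 ^ 25 * Real.sqrt n := by gcongr
        _ ≤ 2 ^ ℓ := hk
    have h4 : 2 ^ (24 + δ) ≤ 2 ^ ℓ := by exact_mod_cast h3
    exact le_trans (Nat.pow_le_pow_right (by norm_num) (by omega)) h4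
  obtain ⟨m, rfl⟩ : ∃ m, ℓ = m + 1 := by
    rcases ℓ with _ | m
    · have : 2 ^ 24 ≤ 2 ^ (24 * κ) := Nat.pow_le_pow_right (by norm_num) (by omega)
      norm_num at hlarge
      omega
    · exact ⟨m, rfl⟩
  obtain ⟨a, ha⟩ : ∃ a, a = 2 ^ (m + 1) / (12 * κ) := ⟨_, rfl⟩
  have ha20 : 2 ^ (20 * κ) ≤ a := by
    rw [ha, Nat.le_div_iff_mul_le (by omega)]
    refine le_trans ?_ hlarge
    have h1 : 12 * κ ≤ 2 ^ (4 * κ) := by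
      have h2 : κ < 2 ^ κ := Nat.lt_two_pow_self
      have h3 : 2 ^ 3 ≤ 2 ^ (3 * κ) := Nat.pow_le_pow_right (by norm_num) (by omega)
      have h4 : 2 ^ (4 * κ) = 2 ^ (3 * κ) * 2 ^ κ := by rw [← pow_add]; congr 1; omega
      have h5 : κ + 1 ≤ 2 ^ κ := h2
      rw [h4]
      rcases Nat.lt_or_ge κ 2 with h | h
      · have : κ = 1 := by omega
        subst this
        norm_num
      · have h6 : 2 ^ 6 ≤ 2 ^ (3 * κ) := Nat.pow_le_pow_right (by norm_num) (by omega)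
        exact Nat.mul_le_mul (by omega) h2.le
    calc 2 ^ (20 * κ) * (12 * κ) ≤ 2 ^ (20 * κ) * 2 ^ (4 * κ) := Nat.mul_le_mul_left _ h1
      _ = 2 ^ (24 * κ) := by rw [← pow_add]; congr 1; omega
  obtain ⟨g, hg, hGg⟩ := hscale m a ha ha20
  have hT : 6 * κ * a ≤ 2 ^ m := by
    have h1 : 12 * κ * a ≤ 2 ^ (m + 1) := by
      rw [ha]
      exact Nat.mul_div_le _ _
    have h2 : 12 * κ * a = 2 * (6 * κ * a) := by ring
    rw [pow_succ] at h1
    omega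
  have hMT : 2 * κ * a ≤ 6 * κ * a := by gcongr; norm_num
  have hpow : 2 ^ (m + 1) = 2 * 2 ^ m := by rw [pow_succ]; ring
  have hE := CellProbe.expectedInfoTransfer_ge (by positivity) hpq hg hGg F (fun i => rfl) hA hΩ
    (t₀ := t₀) (t₁ := t₁) (t₂ := t₂) (by omega) (by omega) (by omega) h2n
  set E := CellProbe.expectedInfoTransfer A (PMF.uniformOfFinset _ hΩ) t₀ t₁ t₂
  have hE0 : 0 ≤ E := Finset.sum_nonneg fun _ _ => by positivity
  -- For `w = 0` the quotient `δ / w` is 0 by convention.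
  rcases Nat.eq_zero_or_pos w with rfl | hw
  · simpa using hE0
  have hML : (2 : ℝ) ^ (m + 1) ≤ 12 * (2 * κ * a : ℕ) := by
    have h1 : 2 ^ (m + 1) < 12 * κ * (a + 1) := by
      rw [ha]
      exact Nat.lt_mul_div_succ _ (by omega)
    have h2 : 1 ≤ a := le_trans Nat.one_le_two_pow ha20
    have h3 : 12 * κ * (a + 1) ≤ 12 * κ * (2 * a) := Nat.mul_le_mul_left _ (by omega)
    have h4 : 2 ^ (m + 1) ≤ 12 * (2 * κ * a) := by
      calc 2 ^ (m + 1) ≤ 12 * κ * (2 * a) := h1.le.trans h3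
        _ = 12 * (2 * κ * a) := by ring
    exact_mod_cast h4
  have hκδ : (δ : ℝ) ≤ 24 * κ := by
    have : δ ≤ 24 * κ := by omega
    exact_mod_cast this
  have hM8 : (8 : ℝ) ≤ (2 * κ * a : ℕ) := by
    have h1 : 2 ^ 20 ≤ a :=
      le_trans (Nat.pow_le_pow_right (by norm_num) (by omega)) ha20
    have h2 : 8 ≤ 2 * κ * a := by
      calc 8 ≤ 2 * 1 * 2 ^ 20 := by norm_num
        _ ≤ 2 * κ * a := by gcongr
    exact_mod_cast h2
  generalize ((2 * κ * a : ℕ) : ℝ) = M at hE hML hM8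
  rw [Nat.cast_pow, Real.log_pow] at hE
  have hlog := Real.log_two_gt_d9
  have hκR : (1 : ℝ) ≤ κ := by exact_mod_cast hκ1
  have hwR : (0 : ℝ) < w := by exact_mod_cast hw
  have hMκ : 8 ≤ M * κ := by nlinarith
  have h4 : M * κ ≤ 4 * (w * E) := by
    have h5 : M * κ * Real.log 2 - 2 ≤ 2 * (w * E) * Real.log 2 := by
      push_cast at hE
      linarith
    -- The additive loss 2 is absorbed by half of the main term. The final constant is `1152 = 24 *
    -- 12 * 4`.
    have h6 : 2 ≤ M * κ / 2 * Real.log 2 := by nlinarith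
    have h7 : M * κ * Real.log 2 ≤ 4 * (w * E) * Real.log 2 := by linarith
    exact le_of_mul_le_mul_right h7 (by linarith)
  have h8 : (δ : ℝ) * 2 ^ (m + 1) ≤ 24 * κ * (12 * M) := by gcongr
  have h9 : (δ : ℝ) / w * 2 ^ (m + 1) ≤ 1152 * E := by
    rw [div_mul_eq_mul_div, div_le_iff₀ hwR]
    linarith
  linarith
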